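/- Let $A$ be an arbitrary (not necessarily unital) $C^*$-algebra and let $X$ be a (right) Hilbert $A$-module, with inner product $\langle\cdot,\cdot\rangle$ linear in the second variable. Let $M(A)=\mathbb B(A)$ be the multiplier algebra of $A$ and $M(X)=\mathbb B(A,X)$ the multiplier module of $X$ (adjointable operators $A\to X$, with $\langle v,w\rangle=v^*w\in M(A)$), where $X\subseteq M(X)$ via $x\mapsto(a\mapsto xa)$; for $v\in M(X)$, $x\in X$ one has $\langle v,x\rangle=v^*x\in A$. For a Hilbert $C^*$-module $Y$ let $\theta_{y,x}(z)=y\langle x,z\rangle$ and let $\mathbb F(Y)$ be the linear span of all $\theta_{y,x}$, $x,y\in Y$. Call $X$ AFG if $X=\{\sum_{n=1}^N x_na_n: a_n\in A\}$ for some finite sequence $(x_n)_{n=1}^N$ in $X$. A finite or infinite sequence $(x_n)_n$ in $M(X)$ has Bessel bound $B>0$ if for every $x\in X$ the series $\sum_n\langle x,x_n\rangle\langle x_n,x\rangle$ converges in norm and is at most $B\langle x,x\rangle$. A sequence having a Bessel bound is called a Bessel sequence if all $x_n\in X$, and an outer Bessel sequence if some $x_n\in M(X)\setminus X$; its optimal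 Bessel bound is the infimum of its Bessel bounds, and its analysis operator is the adjointable operator $U:X\to\ell^2(A)$ (or $A^N$), $Ux=(\langle x_n,x\rangle)_n$. If $\sum_n\langle x,x_n\rangle\langle x_n,x\rangle=\langle x,x\rangle$ in norm for all $x\in X$, the sequence is called a Parseval frame for $X$ if all $x_n\in X$, and an outer Parseval frame for $X$ if some $x_n\in M(X)\setminus X$. A finite extension of $(x_n)_n$ is obtained by adjoining finitely many elements. **Theorem.** (1) Let $(x_n)_n$ be a Bessel or an outer Bessel sequence with analysis operator $U$ and optimal Bessel bound $B$. Then $(x_n)_n$ can be extended by finitely many elements of $M(X)$ to a Parseval frame or an outer Parseval frame for $X$ if and only if $B\le 1$ and there is $\theta\in\mathbb F(M(X))$ such that $I-U^*U=\theta|_X$. (2) Let $(x_n)_n$ be a Bessel sequence in $X$ with analysis operator $U$ and optimal Bessel bound $B$. (a) If $X$ is not AFG, then $(x_n)_n$ can be extended by finitely many elements of $X$ to a Parseval frame for $X$ if and only if $I-U^*U\in\mathbb F(X)$ and $B=1$. (b) If $X$ is AFG, then $(x_n)_n$ can be extended by finitely many elements of $X$ to a Parseval frame for $X$ if and only if $B\le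 1$. -/

import Mathlib

open scoped RightActions
open MulOpposite

set_option linter.unusedSectionVars false

namespace HilbertMod

/-! ### Right Hilbert `C⋆`-modules

Mathlib's `CStarModule B X` is a Hilbert module whose scalars act on the left.  A right Hilbert
module `X` over the (not necessarily unital) `C⋆`-algebra `A` is the same as a `CStarModule` over the
opposite algebra `Aᵐᵒᵖ`: the right action is `x <• a = op a • x`, and the `A`-valued inner product,
conjugate linear in the first and `A`-linear in the second variable, is `ip A x y` below. -/

/-- The `A`-valued inner product `⟨x, y⟩` of a right module. -/
def ip (A : Type*) {X : Type*} [Inner Aᵐᵒᵖ X] (x y : X) : A := unop (inner Aᵐᵒᵖ x y)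

section basic

variable {A : Type*} [NonUnitalCStarAlgebra A] [PartialOrder A] [StarOrderedRing A]

/-- The algebra `A` as a right Hilbert module over itself, `⟨a, b⟩ = a⋆ b`. -/
noncomputable instance instSelf : CStarModule Aᵐᵒᵖ A where
  inner a b := op (star a * b)
  inner_add_right := by intros; simp [mul_add]
  inner_self_nonneg {x} := by
    change op (0 : A) ≤ op (star x * x)
    exact op_le_op.2 (star_mul_self_nonneg x)
  inner_self {x} := by simp
  inner_op_smul_right {a x y} := by
    apply unop_injective
    change star x * (y * a.unop) = (star x * y) * a.unop
    rw [mul_assoc]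
  inner_smul_right_complex := by intros; simp [mul_smul_comm]
  star_inner x y := by
    apply unop_injective
    simp
  norm_eq_sqrt_norm_inner_self x := by
    rw [MulOpposite.norm_op, CStarRing.norm_star_mul_self, Real.sqrt_mul_self (norm_nonneg x)]

theorem ip_self (a b : A) : ip A a b = star a * b := rfl

variable {X : Type*} [AddCommGroup X] [Module ℂ X] [Norm X] [SMul Aᵐᵒᵖ X] [CStarModule Aᵐᵒᵖ X]

theorem ip_add_right (x y z : X) : ip A x (y + z) = ip A x y + ip A x z := by simp [ip]

theorem ip_sub_right (x y z : X) : ip A x (y - z) = ip A x y - ip A x z := by simp [ip]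

theorem ip_smul_right (c : ℂ) (x y : X) : ip A x (c • y) = c • ip A x y := by simp [ip]

theorem ip_op_smul_right (a : A) (x y : X) : ip A x (y <• a) = ip A x y * a := by simp [ip]

theorem star_ip (x y : X) : star (ip A x y) = ip A y x := by simp [ip, ← unop_star]

theorem ip_add_left (x y z : X) : ip A (x + y) z = ip A x z + ip A y z := by simp [ip]

theorem ip_sub_left (x y z : X) : ip A (x - y) z = ip A x z - ip A y z := by simp [ip]

theorem ip_smul_left (c : ℂ) (x y : X) : ip A (c • x) y = star c • ip A x y := by simp [ip]

theorem ip_op_smul_left (a : A) (x y : X) : ip A (x <• a) y = star a * ip A x y := by simp [ip]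

theorem ip_self_nonneg (x : X) : 0 ≤ ip A x x :=
  op_le_op.1 (CStarModule.inner_self_nonneg (A := Aᵐᵒᵖ) (x := x))

theorem norm_ip_self (x : X) : ‖ip A x x‖ = ‖x‖ ^ 2 := by
  rw [CStarModule.norm_sq_eq Aᵐᵒᵖ]; rfl

theorem eq_of_ip_left {x y : X} (h : ∀ z : X, ip A x z = ip A y z) : x = y := by
  have h0 : ip A (x - y) (x - y) = 0 := by rw [ip_sub_left, h, sub_self]
  exact sub_eq_zero.1 ((CStarModule.inner_self (A := Aᵐᵒᵖ)).1 (unop_injective h0))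

theorem eq_of_ip_right {x y : X} (h : ∀ z : X, ip A z x = ip A z y) : x = y :=
  eq_of_ip_left (A := A) fun z => by rw [← star_ip z x, ← star_ip z y, h]

/-- The inner product as a function of its second variable, a bounded linear map. -/
noncomputable def ipR {X : Type*} [NormedAddCommGroup X] [NormedSpace ℂ X]
    [SMul Aᵐᵒᵖ X] [CStarModule Aᵐᵒᵖ X] (x : X) : X →L[ℂ] A :=
  ((MulOpposite.opContinuousLinearEquiv ℂ (M := A)).symm : Aᵐᵒᵖ →L[ℂ] A).comp
    (CStarModule.innerSL (A := Aᵐᵒᵖ) x)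

theorem ipR_apply {X : Type*} [NormedAddCommGroup X] [NormedSpace ℂ X]
    [SMul Aᵐᵒᵖ X] [CStarModule Aᵐᵒᵖ X] (x y : X) : ipR (A := A) x y = ip A x y := rfl

end basic

/-! ### Adjointable operators -/

/-- An adjointable operator `T : X → Y`, i.e. a map for which there is a map `T⋆ : Y → X` with
`⟨T x, y⟩ = ⟨x, T⋆ y⟩`.  On Hilbert modules the adjoint is unique and linearity, `A`-linearity and
boundedness of both maps are automatic. -/
@[ext] structure Adjointable (A X Y : Type*) [Inner Aᵐᵒᵖ X] [Inner Aᵐᵒᵖ Y] where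
  toFun : X → Y
  adj : Y → X
  ip_toFun : ∀ x y, ip A (toFun x) y = ip A x (adj y)

namespace Adjointable

variable {A : Type*} [NonUnitalCStarAlgebra A] [PartialOrder A] [StarOrderedRing A]
variable {X : Type*} [AddCommGroup X] [Module ℂ X] [Norm X] [SMul Aᵐᵒᵖ X] [CStarModule Aᵐᵒᵖ X]
variable {Y : Type*} [AddCommGroup Y] [Module ℂ Y] [Norm Y] [SMul Aᵐᵒᵖ Y] [CStarModule Aᵐᵒᵖ Y]

/-- The composition `S T`. -/
def comp {A X Z Y : Type*} [Inner Aᵐᵒᵖ X] [Inner Aᵐᵒᵖ Y] [Inner Aᵐᵒᵖ Z]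
    (S : Adjointable A Z Y) (T : Adjointable A X Z) : Adjointable A X Y where
  toFun x := S.toFun (T.toFun x)
  adj y := T.adj (S.adj y)
  ip_toFun x y := by rw [S.ip_toFun, T.ip_toFun]

/-- The identity operator. -/
def id (A X : Type*) [Inner Aᵐᵒᵖ X] : Adjointable A X X where
  toFun x := x
  adj x := x
  ip_toFun _ _ := rfl

theorem toFun_injective : Function.Injective (toFun : Adjointable A X Y → X → Y) := by
  intro S T h
  refine Adjointable.ext h (funext fun y => eq_of_ip_right (A := A) fun x => ?_)
  rw [← S.ip_toFun, ← T.ip_toFun, h]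

instance : Zero (Adjointable A X Y) :=
  ⟨⟨fun _ => 0, fun _ => 0, fun x y => by simp [ip]⟩⟩

instance : Add (Adjointable A X Y) :=
  ⟨fun S T => ⟨fun x => S.toFun x + T.toFun x, fun y => S.adj y + T.adj y, fun x y => by
    rw [ip_add_left, ip_add_right, S.ip_toFun, T.ip_toFun]⟩⟩

instance : Neg (Adjointable A X Y) :=
  ⟨fun S => ⟨fun x => -S.toFun x, fun y => -S.adj y, fun x y => by
    have := S.ip_toFun x y
    simp only [ip] at this
    simp [ip, this]⟩⟩

instance : Sub (Adjointable A X Y) :=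
  ⟨fun S T => ⟨fun x => S.toFun x - T.toFun x, fun y => S.adj y - T.adj y, fun x y => by
    rw [ip_sub_left, ip_sub_right, S.ip_toFun, T.ip_toFun]⟩⟩

instance : SMul ℂ (Adjointable A X Y) :=
  ⟨fun c S => ⟨fun x => c • S.toFun x, fun y => star c • S.adj y, fun x y => by
    rw [ip_smul_left, ip_smul_right, S.ip_toFun]⟩⟩

instance : SMul ℕ (Adjointable A X Y) :=
  ⟨fun n S => ⟨fun x => n • S.toFun x, fun y => n • S.adj y, fun x y => by
    rw [← Nat.cast_smul_eq_nsmul ℂ, ← Nat.cast_smul_eq_nsmul ℂ, ip_smul_left, ip_smul_right,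
      S.ip_toFun]
    simp⟩⟩

instance : SMul ℤ (Adjointable A X Y) :=
  ⟨fun n S => ⟨fun x => n • S.toFun x, fun y => n • S.adj y, fun x y => by
    rw [← Int.cast_smul_eq_zsmul ℂ, ← Int.cast_smul_eq_zsmul ℂ, ip_smul_left, ip_smul_right,
      S.ip_toFun]
    simp⟩⟩

/-- Adjointable operators form a complex vector space under the pointwise operations. -/
instance : AddCommGroup (Adjointable A X Y) :=
  toFun_injective.addCommGroup _ rfl (fun _ _ => rfl) (fun _ => rfl) (fun _ _ => rfl)
    (fun _ _ => rfl) (fun _ _ => rfl)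

/-- The inclusion of the adjointable operators into all maps. -/
def toFunHom : Adjointable A X Y →+ (X → Y) where
  toFun := toFun
  map_zero' := rfl
  map_add' _ _ := rfl

noncomputable instance : Module ℂ (Adjointable A X Y) :=
  Function.Injective.module ℂ (toFunHom : Adjointable A X Y →+ (X → Y)) toFun_injective
    (fun _ _ => rfl)

/-- The adjoint operator `T⋆`. -/
def adjoint (T : Adjointable A X Y) : Adjointable A Y X where
  toFun := T.adj
  adj := T.toFun
  ip_toFun y x := by rw [← star_ip x, ← T.ip_toFun, star_ip]

theorem map_op_smul (T : Adjointable A X Y) (x : X) (a : A) :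
    T.toFun (x <• a) = T.toFun x <• a :=
  eq_of_ip_left (A := A) fun z => by rw [T.ip_toFun, ip_op_smul_left, ip_op_smul_left, T.ip_toFun]

/-- The rank one operator `θ_{y,x}(z) = y ⟨x, z⟩`. -/
def theta (y : Y) (x : X) : Adjointable A X Y where
  toFun z := y <• ip A x z
  adj w := x <• ip A y w
  ip_toFun z w := by rw [ip_op_smul_left, ip_op_smul_right, star_ip]

variable (A X) in
/-- The operators of finite rank on `X`: the linear span of the `θ_{y,x}`, `x, y ∈ X`. -/
noncomputable def finiteRank : Submodule ℂ (Adjointable A X X) :=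
  Submodule.span ℂ (Set.range fun p : X × X => theta p.1 p.2)

end Adjointable

section modules

variable (A : Type*) [NonUnitalCStarAlgebra A] [PartialOrder A] [StarOrderedRing A]
variable (X : Type*) [AddCommGroup X] [Module ℂ X] [Norm X] [SMul Aᵐᵒᵖ X] [CStarModule Aᵐᵒᵖ X]

/-- `X` is algebraically finitely generated: finitely many elements generate `X` as an
`A`-module, without taking closures. -/
def IsAFG : Prop :=
  ∃ (N : ℕ) (x : Fin N → X), ∀ y : X, ∃ a : Fin N → A, y = ∑ n, x n <• a n

/-! ### The multiplier module -/

/-- The multiplier module `M(X)`, realised as the adjointable operators `A → X`.  For `X = A` this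
is the multiplier algebra `M(A)`, with composition as multiplication. -/
abbrev MulModule : Type _ := Adjointable A A X

variable {A X}

namespace MulModule

/-- The `M(A)`-valued inner product `⟨v, w⟩ = v⋆ w` on `M(X)`. -/
noncomputable def innerM (v w : MulModule A X) : MulModule A A := v.adjoint.comp w

/-- The right action of `M(A)` on `M(X)`. -/
noncomputable def act (v : MulModule A X) (m : MulModule A A) : MulModule A X := v.comp m

/-- The inclusion `X ⊆ M(X)`; the element `x` acts by `a ↦ x a`. -/
noncomputable def incl (x : X) : MulModule A X where
  toFun a := x <• a
  adj y := ip A x y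
  ip_toFun a y := by rw [ip_op_smul_left]; rfl

theorem incl_injective : Function.Injective (incl : X → MulModule A X) := fun _ _ h =>
  eq_of_ip_left (A := A) fun z => congrFun (congrArg Adjointable.adj h) z

/-- For `v ∈ M(X)` and `x ∈ X`, the inner product `⟨v, x⟩`, which lies in `A`. -/
def pair (v : MulModule A X) (x : X) : A := v.adj x

theorem innerM_incl (v : MulModule A X) (x : X) : innerM v (incl x) = incl (pair v x) :=
  Adjointable.toFun_injective (funext fun a => v.adjoint.map_op_smul x a)

theorem pair_incl (x y : X) : pair (incl x : MulModule A X) y = ip A x y := rfl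

/-- The rank one operator `θ_{v,w}(z) = v ⟨w, z⟩` on `M(X)`. -/
noncomputable def theta (v w : MulModule A X) : MulModule A X → MulModule A X := fun z => act v (innerM w z)

variable (A X) in
/-- The operators of finite rank on `M(X)`: the linear span of the `θ_{v,w}`, `v, w ∈ M(X)`. -/
noncomputable def finiteRank : Submodule ℂ (MulModule A X → MulModule A X) :=
  Submodule.span ℂ (Set.range fun p : MulModule A X × MulModule A X => theta p.1 p.2)

end MulModule

end modules

/-! ### The generalized Hilbert space `ℓ²(A)` -/

section l2

variable {A : Type*} [NonUnitalCStarAlgebra A] [PartialOrder A] [StarOrderedRing A] {ι : Type*}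

theorem summable_of_nonneg_of_le {f g : ι → A} (h0 : ∀ i, 0 ≤ f i) (h : ∀ i, f i ≤ g i)
    (hg : Summable g) : Summable f := by
  rw [summable_iff_vanishing_norm] at hg ⊢
  intro ε hε
  obtain ⟨s, hs⟩ := hg ε hε
  refine ⟨s, fun t ht => lt_of_le_of_lt ?_ (hs t ht)⟩
  exact CStarAlgebra.norm_le_norm_of_nonneg_of_le (Finset.sum_nonneg fun i _ => h0 i)
    (Finset.sum_le_sum fun i _ => h i)

theorem star_add_mul_add_le (a b : A) :
    star (a + b) * (a + b) ≤ (2 : ℂ) • (star a * a) + (2 : ℂ) • (star b * b) := by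
  have h := star_mul_self_nonneg (a - b)
  rw [← sub_nonneg]
  convert h using 1
  simp only [star_add, star_sub, mul_add, add_mul, mul_sub, sub_mul, two_smul]
  abel

/-- The space of all families `(a_n)` in `A` for which `∑ a_n⋆ a_n` converges in norm.  (A
convergent series of positive elements converges unconditionally.) -/
noncomputable def l2Submodule (ι A : Type*) [NonUnitalCStarAlgebra A] [PartialOrder A]
    [StarOrderedRing A] : Submodule ℂ (ι → A) where
  carrier := {a | Summable fun n => star (a n) * a n}
  zero_mem' := by simp
  add_mem' {a b} ha hb :=
    summable_of_nonneg_of_le (fun _ => star_mul_self_nonneg _)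
      (fun n => star_add_mul_add_le (a n) (b n)) ((ha.const_smul (2 : ℂ)).add (hb.const_smul (2 : ℂ)))
  smul_mem' c a ha := by
    have := Summable.const_smul (star c * c) ha
    simpa [smul_mul_smul_comm] using this

/-- The generalized Hilbert space `ℓ²(A)`, indexed by `ι`.  It is `Aᴺ` when `ι` is `Fin N`. -/
def L2 (ι A : Type*) [NonUnitalCStarAlgebra A] [PartialOrder A] [StarOrderedRing A] : Type _ :=
  l2Submodule ι A

noncomputable instance : AddCommGroup (L2 ι A) := inferInstanceAs (AddCommGroup (l2Submodule ι A))

noncomputable instance : Module ℂ (L2 ι A) := inferInstanceAs (Module ℂ (l2Submodule ι A))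

theorem L2.summable_self (a : L2 ι A) : Summable fun n => star (a.1 n) * a.1 n := a.2

theorem L2.summable (a b : L2 ι A) : Summable fun n => star (a.1 n) * b.1 n := by
  have h1 := (L2.summable_self (a + b)).sub (L2.summable_self (a - b))
  have h2 := (L2.summable_self (a + Complex.I • b)).sub (L2.summable_self (a - Complex.I • b))
  have h := (h1.sub (h2.const_smul Complex.I)).const_smul (1 / 4 : ℂ)
  refine h.congr fun n => ?_
  change (1 / 4 : ℂ) • ((star (a.1 n + b.1 n) * (a.1 n + b.1 n)
    - star (a.1 n - b.1 n) * (a.1 n - b.1 n))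
    - Complex.I • (star (a.1 n + Complex.I • b.1 n) * (a.1 n + Complex.I • b.1 n)
    - star (a.1 n - Complex.I • b.1 n) * (a.1 n - Complex.I • b.1 n))) = star (a.1 n) * b.1 n
  simp only [star_add, star_sub, star_smul, mul_add, add_mul, mul_sub, sub_mul, smul_mul_assoc,
    mul_smul_comm, smul_sub, smul_add, smul_smul, Complex.star_def, Complex.conj_I]
  ring_nf
  simp only [Complex.I_sq]
  module

/-- The right action `(a_n) b = (a_n b)`. -/
noncomputable instance : SMul Aᵐᵒᵖ (L2 ι A) :=
  ⟨fun b a => ⟨fun n => a.1 n * b.unop, by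
    have := (a.summable_self.mul_left (star b.unop)).mul_right b.unop
    refine this.congr fun n => ?_
    simp [mul_assoc]⟩⟩

/-- The norm `‖a‖ = ‖∑ a_n⋆ a_n‖^{1/2}`. -/
noncomputable instance : Norm (L2 ι A) := ⟨fun a => √‖∑' n, star (a.1 n) * a.1 n‖⟩

/-- `ℓ²(A)` with the inner product `⟨a, b⟩ = ∑ a_n⋆ b_n`, the series converging in norm. -/
noncomputable instance : CStarModule Aᵐᵒᵖ (L2 ι A) where
  inner a b := op (∑' n, star (a.1 n) * b.1 n)
  inner_add_right {x y z} := by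
    rw [← op_add, ← (x.summable y).tsum_add (x.summable z)]
    simp only [← mul_add]
    rfl
  inner_self_nonneg {x} := by
    change op (0 : A) ≤ op _
    exact op_le_op.2 (tsum_nonneg fun n => star_mul_self_nonneg _)
  inner_self {x} := by
    rw [op_eq_zero_iff]
    constructor
    · intro h
      have h2 := (hasSum_zero_iff_of_nonneg (fun n => star_mul_self_nonneg (x.1 n))).1
        (h ▸ x.summable_self.hasSum)
      refine Subtype.ext (funext fun n => ?_)
      exact (CStarRing.star_mul_self_eq_zero_iff _).1 (congrFun h2 n)
    · rintro rfl
      have : ∀ n, (0 : L2 ι A).1 n = 0 := fun _ => rfl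
      simp [this]
  inner_op_smul_right {a x y} := by
    apply unop_injective
    change ∑' n, star (x.1 n) * (y.1 n * a.unop) = (∑' n, star (x.1 n) * y.1 n) * a.unop
    rw [← (x.summable y).tsum_mul_right]
    simp only [mul_assoc]
  inner_smul_right_complex {z x y} := by
    rw [← op_smul, ← (x.summable y).tsum_const_smul]
    congr 1
    refine tsum_congr fun n => ?_
    exact mul_smul_comm z _ _
  star_inner x y := by
    rw [← op_star, tsum_star]
    simp
  norm_eq_sqrt_norm_inner_self x := rfl

end l2

/-! ### Bessel sequences and frames

Families are indexed by a type `ι`; the sequences of frame theory are the cases `ι = ℕ` and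
`ι = Fin N`.  All series below consist of positive elements of `A`, so norm convergence in the usual
order of the indices is the same as unconditional norm convergence (`Summable`, `HasSum`). -/

section frames

variable {A : Type*} [NonUnitalCStarAlgebra A] [PartialOrder A] [StarOrderedRing A]
variable {X : Type*} [NormedAddCommGroup X] [NormedSpace ℂ X] [SMul Aᵐᵒᵖ X] [CStarModule Aᵐᵒᵖ X]
variable {ι : Type*}

open MulModule

/-- `B > 0` is a Bessel bound for the family `v` in `M(X)`: for all `x ∈ X`, the series
`∑ ⟨x, v_n⟩ ⟨v_n, x⟩` converges in norm and its sum is at most `B ⟨x, x⟩`. -/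
def IsBesselBound (v : ι → MulModule A X) (B : ℝ) : Prop :=
  0 < B ∧ ∀ x : X, (Summable fun n => star (pair (v n) x) * pair (v n) x) ∧
    ∑' n, star (pair (v n) x) * pair (v n) x ≤ B • ip A x x

/-- The optimal Bessel bound. -/
noncomputable def optimalBesselBound (v : ι → MulModule A X) : ℝ := sInf {B | IsBesselBound v B}

/-- `v` is a Bessel sequence: all its members lie in `X` and it has a Bessel bound. -/
def IsBessel (v : ι → MulModule A X) : Prop :=
  (∀ n, v n ∈ Set.range incl) ∧ ∃ B, IsBesselBound v B

/-- `v` is an outer Bessel sequence: some member lies in `M(X) \ X` and it has a Bessel bound. -/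
def IsOuterBessel (v : ι → MulModule A X) : Prop :=
  (∃ n, v n ∉ Set.range incl) ∧ ∃ B, IsBesselBound v B

/-- The Parseval identity `∑ ⟨x, v_n⟩ ⟨v_n, x⟩ = ⟨x, x⟩` for all `x ∈ X`, in norm. -/
def ParsevalIdentity (v : ι → MulModule A X) : Prop :=
  ∀ x : X, HasSum (fun n => star (pair (v n) x) * pair (v n) x) (ip A x x)

/-- `v` is a Parseval frame for `X`. -/
def IsParsevalFrame (v : ι → MulModule A X) : Prop :=
  (∀ n, v n ∈ Set.range incl) ∧ ParsevalIdentity v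

/-- `v` is an outer Parseval frame for `X`. -/
def IsOuterParsevalFrame (v : ι → MulModule A X) : Prop :=
  (∃ n, v n ∉ Set.range incl) ∧ ParsevalIdentity v

theorem exists_besselBound {v : ι → MulModule A X} (hv : IsBessel v ∨ IsOuterBessel v) :
    ∃ B, IsBesselBound v B := hv.elim And.right And.right

theorem sum_le_of_besselBound {v : ι → MulModule A X} {B : ℝ} (hB : IsBesselBound v B)
    (a : ι → A) (s : Finset ι) :
    ‖∑ n ∈ s, (v n).toFun (a n)‖ ^ 2 ≤ B * ‖∑ n ∈ s, star (a n) * a n‖ := by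
  set y := ∑ n ∈ s, (v n).toFun (a n) with hy
  set b : ι → A := fun n => pair (v n) y with hb
  have h1 : ∑ n ∈ s, star (b n) * a n = ip A y y := by
    conv_rhs => rw [← ipR_apply, hy, map_sum]
    refine Finset.sum_congr rfl fun n _ => ?_
    rw [ipR_apply, ← star_ip, (v n).ip_toFun, ip_self, star_mul, star_star]
    rfl
  have h2 : ∑ n ∈ s, star (a n) * b n = ip A y y := by
    rw [← star_ip y y, ← h1, star_sum]
    simp
  have h3 : ∑ n ∈ s, star (b n) * b n ≤ B • ip A y y :=
    ((hB.2 y).1.sum_le_tsum s fun n _ => star_mul_self_nonneg _).trans (hB.2 y).2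
  have h4 : (0 : A) ≤ ∑ n ∈ s, star (B • a n - b n) * (B • a n - b n) :=
    Finset.sum_nonneg fun n _ => star_mul_self_nonneg _
  have h5 : ∑ n ∈ s, star (B • a n - b n) * (B • a n - b n) =
      (B * B) • (∑ n ∈ s, star (a n) * a n) - B • ip A y y - B • ip A y y
        + ∑ n ∈ s, star (b n) * b n := by
    nth_rewrite 1 [← h2]
    rw [← h1]
    simp only [Finset.smul_sum, ← Finset.sum_sub_distrib, ← Finset.sum_add_distrib]
    refine Finset.sum_congr rfl fun n _ => ?_
    simp only [star_sub, star_smul, sub_mul, mul_sub, smul_mul_assoc, mul_smul_comm, star_trivial]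
    module
  have h6 : B • ip A y y ≤ B • (B • ∑ n ∈ s, star (a n) * a n) := by
    rw [smul_smul, ← sub_nonneg]
    rw [h5] at h4
    refine h4.trans ?_
    have := add_le_add_right h3
      ((B * B) • (∑ n ∈ s, star (a n) * a n) - B • ip A y y - B • ip A y y)
    simpa using this
  have h7 : ip A y y ≤ B • ∑ n ∈ s, star (a n) * a n := by
    have := smul_le_smul_of_nonneg_left h6 (inv_nonneg.2 hB.1.le)
    rwa [inv_smul_smul₀ hB.1.ne', inv_smul_smul₀ hB.1.ne'] at this
  have h8 := CStarAlgebra.norm_le_norm_of_nonneg_of_le (ip_self_nonneg y) h7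
  rwa [norm_ip_self, norm_smul, Real.norm_of_nonneg hB.1.le] at h8

theorem summable_synthesis [CompleteSpace X] {v : ι → MulModule A X} {B : ℝ}
    (hB : IsBesselBound v B) (a : L2 ι A) : Summable fun n => (v n).toFun (a.1 n) := by
  rw [summable_iff_vanishing_norm]
  intro ε hε
  obtain ⟨s, hs⟩ := summable_iff_vanishing_norm.1 a.summable_self (ε ^ 2 / B)
    (div_pos (pow_pos hε 2) hB.1)
  refine ⟨s, fun t ht => lt_of_pow_lt_pow_left₀ 2 hε.le ?_⟩
  refine (sum_le_of_besselBound hB a.1 t).trans_lt ?_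
  have := hs t ht
  rwa [lt_div_iff₀' hB.1] at this

/-- The analysis operator `U x = (⟨v_n, x⟩)_n` from `X` to `ℓ²(A)`.  Its adjoint is the synthesis
operator `(a_n) ↦ ∑ v_n a_n`. -/
noncomputable def analysis [CompleteSpace X] (v : ι → MulModule A X)
    (hv : IsBessel v ∨ IsOuterBessel v) : Adjointable A X (L2 ι A) where
  toFun x := ⟨fun n => pair (v n) x, ((exists_besselBound hv).choose_spec.2 x).1⟩
  adj a := ∑' n, (v n).toFun (a.1 n)
  ip_toFun x a := by
    have h := ((summable_synthesis (exists_besselBound hv).choose_spec a).hasSum.mapL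
      (ipR (A := A) x)).tsum_eq
    rw [ipR_apply] at h
    rw [← h]
    refine tsum_congr fun n => ?_
    change star (pair (v n) x) * a.1 n = ip A x ((v n).toFun (a.1 n))
    rw [← star_ip, (v n).ip_toFun, ip_self, star_mul, star_star]
    rfl

/-- `v` has a finite extension to a Parseval or an outer Parseval frame for `X`: finitely many
members of `M(X)` can be adjoined so that the result is such a frame. -/
def HasParsevalOrOuterExtension (v : ι → MulModule A X) : Prop :=
  ∃ (N : ℕ) (f : Fin N → MulModule A X),
    IsParsevalFrame (Sum.elim f v) ∨ IsOuterParsevalFrame (Sum.elim f v)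

/-- `v` has a finite extension, by members of `X`, to a Parseval frame for `X`. -/
def HasParsevalExtension (v : ι → MulModule A X) : Prop :=
  ∃ (N : ℕ) (f : Fin N → X), IsParsevalFrame (Sum.elim (fun n => incl (f n)) v)

end frames

end HilbertMod

namespace HilbertMod

/-! ### Inner product estimates and boundedness of adjointable operators. -/

section normed

variable {A : Type*} [NonUnitalCStarAlgebra A] [PartialOrder A] [StarOrderedRing A]
variable {X : Type*} [NormedAddCommGroup X] [NormedSpace ℂ X] [SMul Aᵐᵒᵖ X] [CStarModule Aᵐᵒᵖ X]
variable {Y : Type*} [NormedAddCommGroup Y] [NormedSpace ℂ Y] [SMul Aᵐᵒᵖ Y] [CStarModule Aᵐᵒᵖ Y]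

/-! Put `T = I - U⋆U`. Adjoining `f_1, …, f_N` yields a Parseval sequence exactly when `T = ∑ f_k
f_k⋆` (`parsevalIdentity_sumElim_iff`, `defect_eq_gram`), so the question is which `T` have this
form. Necessarily `T` is positive, which is the condition `B ≤ 1`, and of finite rank.

Conversely, let `T ≥ 0` be a sum `∑ v_k w_k⋆`. By self-adjointness and polarisation, `T ≤ 2T = ∑
(v_k w_k⋆ + w_k v_k⋆) ≤ ∑ (v_k v_k⋆ + w_k w_k⋆)`. Write the last sum as `s² = ∑ u_j u_j⋆` and put `r
= √T`. Formally `f_j = r s⁻¹ u_j` satisfies `∑ f_j f_j⋆ = r² = T`. Since `s` need not be invertible,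
`s⁻¹` is replaced by regularised inverses `q_n`; the inequality `r² ≤ s²` forces `r q_n u_j` to
converge, and the limit stays in `X` if `u_j` is in `X`. This is `exists_sum_of_le`, applied in
`exists_sum_of_eq_sum`. The functional calculus it needs comes from the `C⋆`-algebra structure on
the adjointable operators.

For the dichotomy in the second part: if `B < 1`, then `T` is invertible by the Neumann series, and
an invertible operator of finite rank makes `X` algebraically finitely generated (`isUnit_defect`,
`isAFG_of_isUnit_mem_finiteRank`). On an algebraically finitely generated module the open mapping
theorem makes `∑ θ_{x_n,x_n}` invertible for generators `x_n`, so every adjointable operator has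
finite rank (`mem_finiteRank_of_isAFG`). -/

theorem norm_ip_le (x y : X) : ‖ip A x y‖ ≤ ‖x‖ * ‖y‖ := by
  rw [ip, ← MulOpposite.norm_op, op_unop]
  exact CStarModule.norm_inner_le (A := Aᵐᵒᵖ) X

theorem ip_neg_right (x y : X) : ip A x (-y) = -ip A x y := by simp [ip]

theorem ip_sum_right {κ : Type*} (s : Finset κ) (x : X) (y : κ → X) :
    ip A x (∑ k ∈ s, y k) = ∑ k ∈ s, ip A x (y k) := by
  simpa only [ipR_apply] using map_sum (ipR (A := A) x) y s

theorem continuous_ip : Continuous fun p : X × X => ip A p.1 p.2 :=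
  continuous_unop.comp (CStarModule.continuous_inner (A := Aᵐᵒᵖ) (E := X))

theorem eq_zero_of_ip_self {x : X} (h : ip A x x = 0) : x = 0 := by
  have := norm_ip_self (A := A) x
  rw [h, norm_zero] at this
  exact norm_eq_zero.1 (pow_eq_zero_iff two_ne_zero |>.1 this.symm)

theorem norm_le_norm_of_ip_le {x : X} {y : Y} (h : ip A x x ≤ ip A y y) : ‖x‖ ≤ ‖y‖ := by
  have := CStarAlgebra.norm_le_norm_of_nonneg_of_le (ip_self_nonneg x) h
  rw [norm_ip_self, norm_ip_self] at this
  exact le_of_sq_le_sq this (norm_nonneg _)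

theorem norm_le_of_forall_norm_ip_le {x : X} {c : ℝ} (hc : 0 ≤ c) (h : ∀ z : X, ‖ip A x z‖ ≤ c * ‖z‖) :
    ‖x‖ ≤ c := by
  rcases eq_or_lt_of_le (norm_nonneg x) with h0 | h0
  · rwa [← h0]
  · have h1 := h x
    rw [norm_ip_self, sq] at h1
    exact le_of_mul_le_mul_right h1 h0

namespace Adjointable

theorem map_add (T : Adjointable A X Y) (x y : X) : T.toFun (x + y) = T.toFun x + T.toFun y :=
  eq_of_ip_left (A := A) fun z => by
    rw [T.ip_toFun, ip_add_left, ip_add_left, T.ip_toFun, T.ip_toFun]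

theorem map_smul (T : Adjointable A X Y) (c : ℂ) (x : X) : T.toFun (c • x) = c • T.toFun x :=
  eq_of_ip_left (A := A) fun z => by
    rw [T.ip_toFun, ip_smul_left, ip_smul_left, T.ip_toFun]

theorem ip_adj (T : Adjointable A X Y) (x : X) (y : Y) : ip A (T.adj y) x = ip A y (T.toFun x) := by
  rw [← star_ip, ← T.ip_toFun, star_ip]

/-- An adjointable operator as a linear map. -/
def toLinearMap (T : Adjointable A X Y) : X →ₗ[ℂ] Y where
  toFun := T.toFun
  map_add' := T.map_add
  map_smul' := T.map_smul

/-- Adjointable operators on Hilbert modules are bounded, by the closed graph theorem. -/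
noncomputable def toCLM [CompleteSpace X] [CompleteSpace Y] (T : Adjointable A X Y) : X →L[ℂ] Y where
  toLinearMap := T.toLinearMap
  cont := by
    refine T.toLinearMap.continuous_of_seq_closed_graph fun u x y hu hTu => ?_
    refine eq_of_ip_right (A := A) fun z => ?_
    change _ = ip A z (T.toFun x)
    rw [← T.ip_adj]
    refine tendsto_nhds_unique (((ipR (A := A) z).continuous.tendsto y).comp hTu) ?_
    refine (((ipR (A := A) (T.adj z)).continuous.tendsto x).comp hu).congr fun n => ?_
    exact T.ip_adj _ _

variable [CompleteSpace X] [CompleteSpace Y]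

theorem map_sub (T : Adjointable A X Y) (x y : X) : T.toFun (x - y) = T.toFun x - T.toFun y :=
  T.toCLM.map_sub x y

theorem map_zero (T : Adjointable A X Y) : T.toFun 0 = 0 := T.toCLM.map_zero

theorem toCLM_injective : Function.Injective (toCLM : Adjointable A X Y → X →L[ℂ] Y) :=
  fun _ _ h => toFun_injective (funext fun x => DFunLike.congr_fun h x)

/-- A bound for the adjoint is a bound for the operator. -/
theorem norm_toFun_le_of_adj (T : Adjointable A X Y) {c : ℝ} (hc : 0 ≤ c)
    (h : ∀ y, ‖T.adj y‖ ≤ c * ‖y‖) (x : X) :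
    ‖T.toFun x‖ ≤ c * ‖x‖ := by
  rcases eq_or_lt_of_le (norm_nonneg (T.toFun x)) with h0 | h0
  · rw [← h0]
    positivity
  · refine le_of_mul_le_mul_right ?_ h0
    calc ‖T.toFun x‖ * ‖T.toFun x‖ = ‖ip A x (T.adj (T.toFun x))‖ := by
          rw [← T.ip_toFun, norm_ip_self, sq]
      _ ≤ ‖x‖ * ‖T.adj (T.toFun x)‖ := norm_ip_le _ _
      _ ≤ ‖x‖ * (c * ‖T.toFun x‖) := by gcongr; exact h _
      _ = c * ‖x‖ * ‖T.toFun x‖ := by ring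

/-! ### The `C⋆`-algebra of adjointable operators -/

instance : Mul (Adjointable A X X) := ⟨comp⟩

instance : One (Adjointable A X X) := ⟨id A X⟩

@[simp] theorem sub_toFun (S T : Adjointable A X Y) (x : X) :
    (S - T).toFun x = S.toFun x - T.toFun x := rfl
@[simp] theorem smul_toFun (c : ℂ) (S : Adjointable A X Y) (x : X) :
    (c • S).toFun x = c • S.toFun x := rfl
@[simp] theorem mul_toFun (S T : Adjointable A X X) (x : X) :
    (S * T).toFun x = S.toFun (T.toFun x) := rfl
@[simp] theorem one_toFun (x : X) : (1 : Adjointable A X X).toFun x = x := rfl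

theorem ext_toFun {S T : Adjointable A X Y} (h : ∀ x, S.toFun x = T.toFun x) : S = T :=
  toFun_injective (funext h)

theorem sum_toFun {κ : Type*} (s : Finset κ) (T : κ → Adjointable A X Y) (x : X) :
    (∑ k ∈ s, T k).toFun x = ∑ k ∈ s, (T k).toFun x := by
  rw [← Finset.sum_apply]
  exact congrFun (map_sum (toFunHom : Adjointable A X Y →+ (X → Y)) T s) x

instance : Ring (Adjointable A X X) where
  __ := (inferInstance : AddCommGroup (Adjointable A X X))
  mul_assoc _ _ _ := rfl
  one_mul _ := rfl
  mul_one _ := rfl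
  zero_mul _ := ext_toFun fun _ => rfl
  mul_zero S := ext_toFun fun _ => S.map_zero
  left_distrib S _ _ := ext_toFun fun _ => S.map_add _ _
  right_distrib _ _ _ := ext_toFun fun _ => rfl

noncomputable instance : Algebra ℂ (Adjointable A X X) :=
  Algebra.ofModule (fun _ _ _ => ext_toFun fun _ => rfl) fun _ S _ => ext_toFun fun _ => S.map_smul _ _

instance : StarRing (Adjointable A X X) where
  star := adjoint
  star_involutive _ := rfl
  star_mul _ _ := rfl
  star_add _ _ := rfl

instance : StarModule ℂ (Adjointable A X X) := ⟨fun _ _ => ext_toFun fun _ => rfl⟩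

noncomputable instance : NormedRing (Adjointable A X X) :=
  NormedRing.induced (Adjointable A X X) (X →L[ℂ] X)
    { toFun := toCLM, map_zero' := rfl, map_add' := fun _ _ => rfl, map_one' := rfl,
      map_mul' := fun _ _ => rfl : Adjointable A X X →+* (X →L[ℂ] X) } toCLM_injective

theorem norm_toFun_le (T : Adjointable A X X) (x : X) : ‖T.toFun x‖ ≤ ‖T‖ * ‖x‖ :=
  T.toCLM.le_opNorm x

theorem norm_le_of_forall (T : Adjointable A X X) {c : ℝ} (hc : 0 ≤ c)
    (h : ∀ x, ‖T.toFun x‖ ≤ c * ‖x‖) : ‖T‖ ≤ c :=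
  T.toCLM.opNorm_le_bound hc h

noncomputable instance : NormedAlgebra ℂ (Adjointable A X X) where
  norm_smul_le c T := norm_smul_le c T.toCLM

/-- The `C⋆`-inequality is Cauchy–Schwarz applied to `⟨T x, T x⟩ = ⟨x, T⋆T x⟩`. -/
instance : CStarRing (Adjointable A X X) where
  norm_mul_self_le T := by
    rw [← sq]
    refine (Real.le_sqrt (norm_nonneg _) (norm_nonneg _)).1 ?_
    refine T.norm_le_of_forall (Real.sqrt_nonneg _) fun x => ?_
    refine le_of_sq_le_sq ?_ (by positivity)
    rw [mul_pow, Real.sq_sqrt (norm_nonneg _), ← norm_ip_self (A := A), T.ip_toFun]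
    calc _ ≤ ‖x‖ * ‖(star T * T).toFun x‖ := norm_ip_le _ _
      _ ≤ ‖x‖ * (‖star T * T‖ * ‖x‖) := by gcongr; exact norm_toFun_le _ _
      _ = _ := by ring

/-- The adjoint is isometric, so the adjoints of a Cauchy sequence are Cauchy too; the limit of the
adjoints is an adjoint of the limit. -/
instance : CompleteSpace (Adjointable A X X) := by
  refine Metric.complete_of_cauchySeq_tendsto fun u hu => ?_
  have hcl : ∀ w : ℕ → Adjointable A X X, CauchySeq w →
      ∃ L : X →L[ℂ] X, Filter.Tendsto (fun n => (w n).toCLM) Filter.atTop (nhds L) := fun w hw =>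
    cauchySeq_tendsto_of_complete
      ((show Isometry (toCLM : Adjointable A X X → X →L[ℂ] X) from
        Isometry.of_dist_eq fun _ _ => rfl).uniformContinuous.comp_cauchySeq hw)
  obtain ⟨L, hL⟩ := hcl u hu
  obtain ⟨M, hM⟩ := hcl (fun n => star (u n))
    ((starₗᵢ ℂ : Adjointable A X X ≃ₗᵢ⋆[ℂ] Adjointable A X X).isometry.uniformContinuous.comp_cauchySeq hu)
  have hLx : ∀ x, Filter.Tendsto (fun n => (u n).toFun x) Filter.atTop (nhds (L x)) := fun x =>
    ((ContinuousLinearMap.apply ℂ X x).continuous.tendsto L).comp hL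
  have hMx : ∀ x, Filter.Tendsto (fun n => (u n).adj x) Filter.atTop (nhds (M x)) := fun x =>
    ((ContinuousLinearMap.apply ℂ X x).continuous.tendsto M).comp hM
  let T : Adjointable A X X := ⟨L, M, fun x y => by
    refine tendsto_nhds_unique ((continuous_ip.tendsto (L x, y)).comp
      ((hLx x).prodMk_nhds tendsto_const_nhds)) ?_
    refine ((continuous_ip.tendsto (x, M y)).comp
      (tendsto_const_nhds.prodMk_nhds (hMx y))).congr fun n => ?_
    exact ((u n).ip_toFun x y).symm⟩
  refine ⟨T, tendsto_iff_dist_tendsto_zero.2 ?_⟩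
  have hTL : T.toCLM = L := ContinuousLinearMap.ext fun _ => rfl
  rw [← hTL] at hL
  have hd := tendsto_iff_dist_tendsto_zero.1 hL
  exact hd

noncomputable instance : CStarAlgebra (Adjointable A X X) where

noncomputable instance : PartialOrder (Adjointable A X X) := CStarAlgebra.spectralOrder _

instance : StarOrderedRing (Adjointable A X X) := CStarAlgebra.spectralOrderedRing _

theorem ip_toFun_comm {T : Adjointable A X X} (hT : IsSelfAdjoint T) (x y : X) :
    ip A (T.toFun x) y = ip A x (T.toFun y) := by
  conv_rhs => rw [← hT.star_eq]
  exact T.ip_toFun x y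

/-- A self-adjoint operator is positive in the `C⋆`-algebra of adjointable operators as soon as
its quadratic form is positive. -/
theorem nonneg_of_ip_nonneg {T : Adjointable A X X} (hT : IsSelfAdjoint T)
    (h : ∀ x, 0 ≤ ip A x (T.toFun x)) : 0 ≤ T := by
  rw [← CFC.negPart_eq_zero_iff T hT]
  set n := T⁻ with hn
  have hn0 : 0 ≤ n := CFC.negPart_nonneg T
  have hTn : T * n = -(n * n) := by
    conv_lhs => rw [← CFC.posPart_sub_negPart T hT]
    rw [sub_mul, CFC.posPart_mul_negPart, zero_sub]
  set m := CFC.sqrt n with hm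
  have hmm : m * m = n := CFC.sqrt_mul_sqrt_self n hn0
  have hms : IsSelfAdjoint m := IsSelfAdjoint.of_nonneg (CFC.sqrt_nonneg n)
  have hmn : m * n = 0 := ext_toFun fun x => by
    refine eq_zero_of_ip_self (A := A) (le_antisymm ?_ (ip_self_nonneg _))
    -- Testing the form at `n x`, where `T` acts as `-n`, gives `-⟨m n x, m n x⟩ ≥ 0`, hence `m n x
    -- = 0`.
    have h1 := h (n.toFun x)
    have h2 : T.toFun (n.toFun x) = -n.toFun (n.toFun x) :=
      congrArg (fun S : Adjointable A X X => S.toFun x) hTn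
    have h3 : n.toFun (n.toFun x) = m.toFun (m.toFun (n.toFun x)) :=
      (congrArg (fun S : Adjointable A X X => S.toFun (n.toFun x)) hmm).symm
    rw [h2, h3, ip_neg_right, ← ip_toFun_comm hms] at h1
    exact neg_nonneg.1 h1
  have hnn : star n * n = 0 := by
    rw [(IsSelfAdjoint.of_nonneg hn0).star_eq]
    nth_rewrite 1 [← hmm]
    rw [mul_assoc, hmn, mul_zero]
  exact (CStarRing.star_mul_self_eq_zero_iff n).1 hnn

/-- Both `S - T` and `T - S` have zero quadratic form, so both are positive. -/
theorem eq_of_ip_eq {S T : Adjointable A X X} (hS : IsSelfAdjoint S) (hT : IsSelfAdjoint T)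
    (h : ∀ x, ip A x (S.toFun x) = ip A x (T.toFun x)) : S = T := by
  refine le_antisymm (sub_nonneg.1 (nonneg_of_ip_nonneg (hT.sub hS) fun x => ?_))
    (sub_nonneg.1 (nonneg_of_ip_nonneg (hS.sub hT) fun x => ?_)) <;>
  simp [ip_sub_right, h]

/-- A positive operator is the square of a self-adjoint one. -/
theorem exists_sqrt {T : Adjointable A X X} (hT : 0 ≤ T) :
    ∃ r : Adjointable A X X, 0 ≤ r ∧ r * r = T :=
  ⟨CFC.sqrt T, CFC.sqrt_nonneg T, CFC.sqrt_mul_sqrt_self T hT⟩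

end Adjointable

end normed

/-! ### Regularised inverses and a Cauchy criterion. -/

/-- A self-adjoint element `s` of a `C⋆`-algebra has approximate inverses `q` in the sense that
`s (1 - s q)` is small. -/
theorem exists_approx_inverse {B : Type*} [CStarAlgebra B] {s : B} (hs : IsSelfAdjoint s) {η : ℝ}
    (hη : 0 < η) : ∃ q : B, IsSelfAdjoint q ∧ Commute s q ∧ ‖s * (1 - s * q)‖ ≤ η := by
  have hpos : ∀ t : ℝ, t ^ 2 + η ^ 2 ≠ 0 := fun t => by positivity
  -- A continuous substitute for `1/t`: the error `t (1 - t φ(t)) = t η² / (t² + η²)` is at most `η`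
  -- in absolute value for every real `t`.
  set φ : ℝ → ℝ := fun t => t / (t ^ 2 + η ^ 2) with hφ
  have hc : Continuous φ := by
    rw [hφ]
    exact continuous_id.div (by fun_prop) hpos
  refine ⟨cfc φ s, cfc_predicate φ s, ((Commute.refl s).cfc_real φ).symm, ?_⟩
  have h : s * (1 - s * cfc φ s) = cfc (fun t : ℝ => t * (1 - t * φ t)) s := by
    rw [cfc_mul (fun t : ℝ => t) (fun t => 1 - t * φ t) s (by fun_prop) (by fun_prop),
      cfc_sub (fun _ : ℝ => (1 : ℝ)) (fun t => t * φ t) s (by fun_prop) (by fun_prop),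
      cfc_mul (fun t : ℝ => t) φ s (by fun_prop) (by fun_prop), cfc_id' ℝ s, cfc_const_one ℝ s]
  rw [h]
  refine norm_cfc_le hη.le fun t _ => ?_
  have h1 : t * (1 - t * φ t) = t * η ^ 2 / (t ^ 2 + η ^ 2) := by
    rw [hφ]
    field_simp [hpos t]
    ring
  rw [h1, Real.norm_eq_abs, abs_div, abs_mul, abs_of_pos (by positivity : 0 < η ^ 2),
    abs_of_pos (by positivity : 0 < t ^ 2 + η ^ 2), div_le_iff₀ (by positivity), ← sq_abs t]
  nlinarith [mul_nonneg hη.le (sq_nonneg (|t| - η)), mul_nonneg (abs_nonneg t) (sq_nonneg η),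
    abs_nonneg t, mul_nonneg hη.le (sq_nonneg (|t|))]

theorem cauchySeq_of_dist_le {E : Type*} [PseudoMetricSpace E] {w : ℕ → E} {η : ℕ → ℝ} (C : ℝ)
    (hη : Antitone η) (h0 : Filter.Tendsto η Filter.atTop (nhds 0)) (hC : 0 ≤ C)
    (h : ∀ n m, dist (w n) (w m) ≤ (η n + η m) * C) : CauchySeq w := by
  refine cauchySeq_of_le_tendsto_0 (fun N => (η N + η N) * C) (fun n m N hn hm => ?_) ?_
  · refine (h n m).trans (mul_le_mul_of_nonneg_right (add_le_add (hη hn) (hη hm)) hC)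
  · simpa using (h0.add h0).mul_const C

/-! ### Positive operators as finite sums `∑ f_k f_k⋆`. -/

section

variable {A : Type*} [NonUnitalCStarAlgebra A] [PartialOrder A] [StarOrderedRing A]
variable {X : Type*} [NormedAddCommGroup X] [NormedSpace ℂ X] [SMul Aᵐᵒᵖ X] [CStarModule Aᵐᵒᵖ X]

open MulModule

theorem Adjointable.adj_injective {Y : Type*} [NormedAddCommGroup Y] [NormedSpace ℂ Y] [SMul Aᵐᵒᵖ Y]
    [CStarModule Aᵐᵒᵖ Y] : Function.Injective (Adjointable.adj : Adjointable A X Y → Y → X) :=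
  fun S T h => congrArg adjoint (@toFun_injective A _ _ _ Y _ _ _ _ _ X _ _ _ _ _ S.adjoint T.adjoint h)

variable [CompleteSpace X]

/-- The positive operator `∑ u_k u_k⋆`. -/
noncomputable def gram {κ : Type*} [Fintype κ] (u : κ → MulModule A X) : Adjointable A X X :=
  ∑ k, (u k).comp (u k).adjoint

theorem gram_toFun {κ : Type*} [Fintype κ] (u : κ → MulModule A X) (x : X) :
    (gram u).toFun x = ∑ k, (u k).toFun ((u k).adj x) :=
  Adjointable.sum_toFun _ _ _

theorem ip_gram {κ : Type*} [Fintype κ] (u : κ → MulModule A X) (x : X) :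
    ip A x ((gram u).toFun x) = ∑ k, star ((u k).adj x) * (u k).adj x := by
  rw [gram_toFun, ip_sum_right]
  exact Finset.sum_congr rfl fun k _ => ((u k).ip_adj _ _).symm

theorem isSelfAdjoint_gram {κ : Type*} [Fintype κ] (u : κ → MulModule A X) :
    IsSelfAdjoint (gram u) :=
  isSelfAdjoint_sum _ fun _ _ => rfl

theorem gram_nonneg {κ : Type*} [Fintype κ] (u : κ → MulModule A X) : 0 ≤ gram u :=
  Adjointable.nonneg_of_ip_nonneg (isSelfAdjoint_gram u) fun x => by
    rw [ip_gram]
    exact Finset.sum_nonneg fun k _ => star_mul_self_nonneg _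

/-- If `s² = ∑ u_k u_k⋆`, then each `u_k⋆` is dominated by `s`. -/
theorem norm_adj_le_of_mul_self_eq_gram {κ : Type*} [Fintype κ] {u : κ → MulModule A X}
    {s : Adjointable A X X} (hs : IsSelfAdjoint s) (hsu : s * s = gram u) (k : κ) (y : X) :
    ‖(u k).adj y‖ ≤ ‖s.toFun y‖ := by
  refine norm_le_norm_of_ip_le (A := A) ?_
  rw [Adjointable.ip_toFun_comm hs, ← Adjointable.mul_toFun, hsu, ip_gram]
  exact Finset.single_le_sum (f := fun k => star ((u k).adj y) * (u k).adj y)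
    (fun k _ => star_mul_self_nonneg _) (Finset.mem_univ k)

/-- A positive operator dominated by `∑ u_k u_k⋆` is itself of the form `∑ f_k f_k⋆`; moreover
`f_k` lies in `X` whenever `u_k` does. -/
theorem exists_sum_of_le {κ : Type*} [Fintype κ] {T : Adjointable A X X} (hT : 0 ≤ T)
    (u : κ → MulModule A X)
    (hle : ∀ x, ip A x (T.toFun x) ≤ ∑ k, star ((u k).adj x) * (u k).adj x) :
    ∃ f : κ → MulModule A X,
      (∀ x, ∑ k, star ((f k).adj x) * (f k).adj x = ip A x (T.toFun x)) ∧
      ∀ k, u k ∈ Set.range incl → f k ∈ Set.range incl := by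
  obtain ⟨r, hr0, hrr⟩ := Adjointable.exists_sqrt hT
  obtain ⟨s, hs0, hss⟩ := Adjointable.exists_sqrt (gram_nonneg u)
  have hr := IsSelfAdjoint.of_nonneg hr0
  have hs := IsSelfAdjoint.of_nonneg hs0
  set η : ℕ → ℝ := fun n => 1 / ((n : ℝ) + 1) with hη
  have hηpos : ∀ n, 0 < η n := fun n => by rw [hη]; positivity
  have hηa : Antitone η := fun n m h => one_div_le_one_div_of_le (by positivity) (by simpa using h)
  have hη0 : Filter.Tendsto η Filter.atTop (nhds 0) := tendsto_one_div_add_atTop_nhds_zero_nat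
  choose q hq hcomm hqe using fun n => exists_approx_inverse hs (hηpos n)
  have hradj : r.adj = r.toFun := congrArg Adjointable.toFun hr.star_eq
  have hqadj : ∀ n, (q n).adj = (q n).toFun := fun n => congrArg Adjointable.toFun (hq n).star_eq
  -- This is `r² ≤ s²`, the only use of the domination hypothesis.
  have hrs : ∀ z, ‖r.toFun z‖ ≤ ‖s.toFun z‖ := fun z => by
    refine norm_le_norm_of_ip_le (A := A) ?_
    rw [Adjointable.ip_toFun_comm hs, Adjointable.ip_toFun_comm hr,
      ← Adjointable.mul_toFun, ← Adjointable.mul_toFun, hss, hrr, ip_gram]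
    exact hle z
  -- The operator `(1 - s q_n) r` is the adjoint of `r (1 - s q_n)`, and by `hrs` the latter is no
  -- larger than `s (1 - s q_n)`, which is small by the choice of `q_n`.
  have her : ∀ n x, ‖r.toFun x - s.toFun ((q n).toFun (r.toFun x))‖ ≤ η n * ‖x‖ := fun n x => by
    have hesa : IsSelfAdjoint (1 - s * q n) :=
      (IsSelfAdjoint.one _).sub ((hs.commute_iff (hq n)).1 (hcomm n))
    have h1 : ‖r * (1 - s * q n)‖ ≤ η n := by
      refine Adjointable.norm_le_of_forall _ (hηpos n).le fun z => ?_
      refine (hrs _).trans ((Adjointable.norm_toFun_le (s * (1 - s * q n)) z).trans ?_)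
      gcongr
      exact hqe n
    have h2 : ‖(1 - s * q n) * r‖ ≤ η n := by
      rw [← norm_star, star_mul, hesa.star_eq, hr.star_eq]
      exact h1
    refine (Adjointable.norm_toFun_le ((1 - s * q n) * r) x).trans ?_
    gcongr
  -- Approximants to the formal solution `r s⁻¹ u_k`.
  set F : ℕ → κ → MulModule A X := fun n k => (r * q n).comp (u k) with hF
  have hFadj : ∀ n k x, (F n k).adj x = (u k).adj ((q n).toFun (r.toFun x)) := fun n k x => by
    change (u k).adj ((q n).adj (r.adj x)) = _
    rw [hradj, hqadj]
  have hdadj : ∀ n m k x, ‖(F n k - F m k).adj x‖ ≤ (η n + η m) * ‖x‖ := fun n m k x => by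
    change ‖(F n k).adj x - (F m k).adj x‖ ≤ _
    rw [hFadj, hFadj]
    have h1 := (u k).adjoint.map_sub ((q n).toFun (r.toFun x)) ((q m).toFun (r.toFun x))
    change (u k).adj _ = (u k).adj _ - (u k).adj _ at h1
    rw [← h1]
    refine (norm_adj_le_of_mul_self_eq_gram hs hss k _).trans ?_
    rw [s.map_sub, ← norm_neg]
    have h2 : -(s.toFun ((q n).toFun (r.toFun x)) - s.toFun ((q m).toFun (r.toFun x))) =
        (r.toFun x - s.toFun ((q n).toFun (r.toFun x)))
          - (r.toFun x - s.toFun ((q m).toFun (r.toFun x))) := by abel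
    rw [h2, add_mul]
    exact (norm_sub_le _ _).trans (add_le_add (her n x) (her m x))
  -- The adjoints are controlled directly, since `u_k⋆` is dominated by `s`; the operators inherit
  -- the same bound.
  have hdto : ∀ n m k a, ‖(F n k).toFun a - (F m k).toFun a‖ ≤ (η n + η m) * ‖a‖ :=
    fun n m k a => (F n k - F m k).norm_toFun_le_of_adj
      (add_nonneg (hηpos n).le (hηpos m).le) (hdadj n m k) a
  have hlim1 : ∀ k a, ∃ y, Filter.Tendsto (fun n => (F n k).toFun a) Filter.atTop (nhds y) :=
    fun k a => cauchySeq_tendsto_of_complete (cauchySeq_of_dist_le ‖a‖ hηa hη0 (norm_nonneg a)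
      fun n m => by rw [dist_eq_norm]; exact hdto n m k a)
  have hlim2 : ∀ k x, ∃ b, Filter.Tendsto (fun n => (F n k).adj x) Filter.atTop (nhds b) :=
    fun k x => cauchySeq_tendsto_of_complete (cauchySeq_of_dist_le ‖x‖ hηa hη0 (norm_nonneg x)
      fun n m => by rw [dist_eq_norm]; exact hdadj n m k x)
  choose g hg using hlim1
  choose h hh using hlim2
  refine ⟨fun k => ⟨g k, h k, fun a x => ?_⟩, fun x => ?_, ?_⟩
  · refine tendsto_nhds_unique ((continuous_ip.tendsto (g k a, x)).comp
      ((hg k a).prodMk_nhds tendsto_const_nhds)) ?_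
    refine ((continuous_ip.tendsto (a, h k x)).comp
      (tendsto_const_nhds.prodMk_nhds (hh k x))).congr fun n => ?_
    exact ((F n k).ip_toFun a x).symm
  · have hlim : Filter.Tendsto (fun n => ∑ k, star ((F n k).adj x) * (F n k).adj x) Filter.atTop
        (nhds (∑ k, star (h k x) * h k x)) :=
      tendsto_finsetSum _ fun k _ => (hh k x).star.mul (hh k x)
    refine tendsto_nhds_unique hlim ?_
    -- The approximating sums equal `⟨s q_n r x, s q_n r x⟩`, and `s q_n r x → r x`.
    have hsq : Filter.Tendsto (fun n => s.toFun ((q n).toFun (r.toFun x))) Filter.atTop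
        (nhds (r.toFun x)) := by
      rw [tendsto_iff_norm_sub_tendsto_zero]
      refine squeeze_zero (fun _ => norm_nonneg _) (fun n => ?_)
        (by simpa using hη0.mul_const ‖x‖)
      rw [norm_sub_rev]
      exact her n x
    have h1 := (continuous_ip (A := A)).tendsto (r.toFun x, r.toFun x) |>.comp (hsq.prodMk_nhds hsq)
    have h2 : ip A x (T.toFun x) = ip A (r.toFun x) (r.toFun x) := by
      rw [Adjointable.ip_toFun_comm hr, ← hrr]
      rfl
    rw [h2]
    refine h1.congr fun n => ?_
    change ip A (s.toFun _) (s.toFun _) = _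
    rw [Adjointable.ip_toFun_comm hs, ← Adjointable.mul_toFun s s, hss, ip_gram]
    simp only [hFadj]
  · rintro k ⟨x₀, hx₀⟩
    -- If `u_k` is given by `x₀ ∈ X`, the approximants are given by `r q_n x₀ ∈ X`. The bound on the
    -- adjoints makes these vectors Cauchy in `X`, and their limit represents `f_k`.
    have hip : ∀ n z, ip A (r.toFun ((q n).toFun x₀)) z = (F n k).adj z := fun n z => by
      rw [hFadj, ← hx₀, Adjointable.ip_toFun_comm hr,
        Adjointable.ip_toFun_comm (hq n)]
      rfl
    obtain ⟨y, hy⟩ := cauchySeq_tendsto_of_complete (cauchySeq_of_dist_le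
      (w := fun n => r.toFun ((q n).toFun x₀)) 1 hηa hη0 zero_le_one fun n m => by
        rw [dist_eq_norm, mul_one]
        refine norm_le_of_forall_norm_ip_le (A := A) (add_nonneg (hηpos n).le (hηpos m).le) fun z => ?_
        rw [ip_sub_left, hip, hip]
        exact hdadj n m k z)
    refine ⟨y, Adjointable.adj_injective (funext fun z => ?_)⟩
    change ip A y z = h k z
    refine tendsto_nhds_unique ((continuous_ip.tendsto (y, z)).comp
      (hy.prodMk_nhds tendsto_const_nhds)) ((hh k z).congr fun n => ?_)
    exact (hip n z).symm

/-- Expand `(a - b)⋆ (a - b) ≥ 0`. -/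
theorem star_mul_add_star_mul_le (a b : A) :
    star a * b + star b * a ≤ star a * a + star b * b := by
  have h := star_mul_self_nonneg (a - b)
  rw [← sub_nonneg]
  convert h using 1
  simp only [star_sub, mul_sub, sub_mul]
  abel

theorem Adjointable.ip_nonneg {T : Adjointable A X X} (hT : 0 ≤ T) (x : X) :
    0 ≤ ip A x (T.toFun x) := by
  obtain ⟨r, hr0, rfl⟩ := exists_sqrt hT
  rw [mul_toFun, ← ip_toFun_comm (IsSelfAdjoint.of_nonneg hr0)]
  exact ip_self_nonneg _

/-- A positive operator of the form `∑ v_k w_k⋆` is of the form `∑ f_k f_k⋆`. -/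
theorem exists_sum_of_eq_sum {n : ℕ} {T : Adjointable A X X} (hT : 0 ≤ T)
    (v w : Fin n → MulModule A X) (hvw : ∀ x, T.toFun x = ∑ k, (v k).toFun ((w k).adj x)) :
    ∃ (N : ℕ) (f : Fin N → MulModule A X),
      (∀ x, ∑ k, star ((f k).adj x) * (f k).adj x = ip A x (T.toFun x)) ∧
      ((∀ k, v k ∈ Set.range incl) → (∀ k, w k ∈ Set.range incl) → ∀ k, f k ∈ Set.range incl) := by
  -- Twice the form of `T` is the symmetrised sum of cross terms, bounded by the squares of the
  -- concatenated family; one copy of `T` is then dropped because it is positive.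
  have hle : ∀ x, ip A x (T.toFun x) ≤
      ∑ k, star ((Fin.append v w k).adj x) * (Fin.append v w k).adj x := fun x => by
    have h1 : ip A x (T.toFun x) = ∑ k, star ((v k).adj x) * (w k).adj x := by
      rw [hvw, ip_sum_right]
      exact Finset.sum_congr rfl fun k _ => ((v k).ip_adj _ _).symm
    have h2 : ip A x (T.toFun x) = ∑ k, star ((w k).adj x) * (v k).adj x := by
      rw [← Adjointable.ip_toFun_comm (IsSelfAdjoint.of_nonneg hT), ← star_ip, h1,
        star_sum]
      simp
    rw [Fin.sum_univ_add]
    simp only [Fin.append_left, Fin.append_right]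
    rw [← Finset.sum_add_distrib]
    refine le_trans ?_ (Finset.sum_le_sum fun k _ =>
      star_mul_add_star_mul_le ((v k).adj x) ((w k).adj x))
    rw [Finset.sum_add_distrib, ← h1, ← h2]
    exact le_add_of_nonneg_right (Adjointable.ip_nonneg hT x)
  obtain ⟨f, hf, hfr⟩ := exists_sum_of_le hT (Fin.append v w) hle
  exact ⟨n + n, f, hf, fun hv hw k => hfr k (k.addCases
    (fun i => by rw [Fin.append_left]; exact hv i) (fun i => by rw [Fin.append_right]; exact hw i))⟩

/-! ### Finite rank operators -/

/-- With `innerM_incl`, this shows that `θ_{v,w}` maps `X` into `X`, acting there as `v w⋆`. -/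
theorem incl_toFun (v : MulModule A X) (a : A) : (incl (v.toFun a) : MulModule A X) = v.comp (incl a) :=
  Adjointable.ext_toFun fun b => (v.map_op_smul a b).symm

variable (A X) in
/-- The inclusion `X ⊆ M(X)` as a linear map. -/
noncomputable def inclLinear : X →ₗ[ℂ] MulModule A X where
  toFun := incl
  map_add' x y := Adjointable.adj_injective (funext fun z => ip_add_left x y z)
  map_smul' c x := Adjointable.adj_injective (funext fun z => ip_smul_left c x z)

end

section

variable {A : Type*} [NonUnitalCStarAlgebra A] [PartialOrder A] [StarOrderedRing A]
variable {X : Type*} [NormedAddCommGroup X] [NormedSpace ℂ X] [SMul Aᵐᵒᵖ X] [CStarModule Aᵐᵒᵖ X]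

open MulModule

variable [CompleteSpace X]

/-- On vectors which it maps into `X`, a finite rank operator on `M(X)` is a sum `∑ v_k w_k⋆`. -/
theorem exists_sum_of_mem_mulModule_finiteRank {θ : MulModule A X → MulModule A X}
    (hθ : θ ∈ MulModule.finiteRank A X) :
    ∃ (n : ℕ) (v w : Fin n → MulModule A X),
      ∀ x y : X, θ (incl x) = incl y → y = ∑ k, (v k).toFun ((w k).adj x) := by
  obtain ⟨n, c, g, rfl⟩ := Submodule.mem_span_set'.1 hθ
  choose p hp using fun k => (g k).2
  refine ⟨n, fun k => c k • (p k).1, fun k => (p k).2, fun x y h => incl_injective (A := A) ?_⟩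
  rw [← h, Finset.sum_apply]
  change _ = inclLinear A X _
  rw [map_sum]
  refine Finset.sum_congr rfl fun k _ => ?_
  rw [Pi.smul_apply, ← hp]
  change c k • (p k).1.comp (innerM (p k).2 (incl x)) = incl (c k • (p k).1.toFun ((p k).2.adj x))
  rw [innerM_incl, ← incl_toFun]
  exact ((inclLinear A X).map_smul _ _).symm

theorem exists_sum_of_mem_finiteRank {T : Adjointable A X X} (hT : T ∈ Adjointable.finiteRank A X) :
    ∃ (n : ℕ) (y z : Fin n → X), ∀ x, T.toFun x = ∑ k, y k <• ip A (z k) x := by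
  obtain ⟨n, c, g, rfl⟩ := Submodule.mem_span_set'.1 hT
  choose p hp using fun k => (g k).2
  refine ⟨n, fun k => c k • (p k).1, fun k => (p k).2, fun x => ?_⟩
  rw [Adjointable.sum_toFun]
  refine Finset.sum_congr rfl fun k _ => ?_
  rw [← hp]
  refine eq_of_ip_left (A := A) fun u => ?_
  rw [Adjointable.smul_toFun, ip_smul_left, ip_op_smul_left, ip_smul_left]
  change star (c k) • ip A ((p k).1 <• ip A (p k).2 x) u = _
  rw [ip_op_smul_left, mul_smul_comm]

/-- Because `S θ_{y,x} = θ_{S y,x}`, the finite rank operators form a left ideal. -/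
theorem mul_mem_finiteRank (S : Adjointable A X X) {T : Adjointable A X X}
    (hT : T ∈ Adjointable.finiteRank A X) : S * T ∈ Adjointable.finiteRank A X := by
  induction hT using Submodule.span_induction with
  | mem T h =>
    obtain ⟨p, rfl⟩ := h
    refine Submodule.subset_span ⟨(S.toFun p.1, p.2), ?_⟩
    exact Adjointable.ext_toFun fun x => (S.map_op_smul _ _).symm
  | zero => rw [mul_zero]; exact zero_mem _
  | add T U _ _ hT hU => rw [mul_add]; exact add_mem hT hU
  | smul c T _ hT => rw [mul_smul_comm]; exact Submodule.smul_mem _ c hT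

theorem gram_incl_mem_finiteRank {κ : Type*} [Fintype κ] (x : κ → X) :
    gram (fun k => (incl (x k) : MulModule A X)) ∈ Adjointable.finiteRank A X :=
  Submodule.sum_mem _ fun k _ => Submodule.subset_span ⟨(x k, x k), rfl⟩

/-- If `T = ∑ θ_{y_k,z_k}` and `T R = 1`, then `x = T R x = ∑ y_k ⟨z_k, R x⟩`, so the `y_k`
generate. -/
theorem isAFG_of_isUnit_mem_finiteRank {T : Adjointable A X X} (hu : IsUnit T)
    (hT : T ∈ Adjointable.finiteRank A X) : IsAFG A X := by
  obtain ⟨n, y, z, h⟩ := exists_sum_of_mem_finiteRank hT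
  obtain ⟨R, hR⟩ := hu.exists_right_inv
  refine ⟨n, y, fun x => ⟨fun k => ip A (z k) (R.toFun x), ?_⟩⟩
  rw [← h, ← Adjointable.mul_toFun, hR, Adjointable.one_toFun]

/-- A self-adjoint operator which is bounded below is invertible. -/
theorem isUnit_of_bounded_below {s : Adjointable A X X} (hs : IsSelfAdjoint s) {K : ℝ} (hK : 0 < K)
    (h : ∀ x, ‖x‖ ≤ K * ‖s.toFun x‖) : IsUnit s := by
  -- The choice of `η` makes `K η = 1/2`, so `s q` is within `1/2` of the identity and invertible;
  -- as `s` and `q` commute, `s` is invertible.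
  obtain ⟨q, -, hc, hq⟩ := exists_approx_inverse hs (η := 1 / (2 * K)) (by positivity)
  have h1 : ‖1 - s * q‖ ≤ 1 / 2 := by
    refine Adjointable.norm_le_of_forall _ (by norm_num) fun x => (h _).trans ?_
    calc K * ‖(s * (1 - s * q)).toFun x‖ ≤ K * (1 / (2 * K) * ‖x‖) := by
          gcongr
          exact (Adjointable.norm_toFun_le _ x).trans (by gcongr)
      _ = 1 / 2 * ‖x‖ := by field_simp
  have h2 := isUnit_one_sub_of_norm_lt_one (h1.trans_lt (by norm_num))
  rw [sub_sub_cancel] at h2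
  exact (hc.isUnit_mul_iff.1 h2).1

/-- If finitely many `x_n` generate `X` algebraically, then `∑ θ_{x_n,x_n}` is invertible. -/
theorem isUnit_gram_of_generating {N : ℕ} {x : Fin N → X}
    (hx : ∀ y : X, ∃ a : Fin N → A, y = ∑ n, x n <• a n) :
    IsUnit (gram fun n => (incl (x n) : MulModule A X)) := by
  let Φ : (Fin N → A) →L[ℂ] X :=
    ∑ n, (incl (x n) : MulModule A X).toCLM.comp (ContinuousLinearMap.proj n)
  have hΦ : ∀ a, Φ a = ∑ n, x n <• a n := fun a => by
    simp only [Φ, sum_apply]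
    rfl
  have hsurj : Function.Surjective Φ := fun y => by
    obtain ⟨a, ha⟩ := hx y
    exact ⟨a, (hΦ a).trans ha.symm⟩
  -- Open mapping theorem: coefficients of `y` can be chosen of norm at most `C ‖y‖`.
  obtain ⟨C, hC, hb⟩ := Φ.exists_preimage_norm_le hsurj
  obtain ⟨s, hs0, hss⟩ := Adjointable.exists_sqrt (gram_nonneg fun n => (incl (x n) : MulModule A X))
  have hs := IsSelfAdjoint.of_nonneg hs0
  -- Expand one factor in `⟨y, y⟩ = ∑ ⟨y, x_n⟩ a_n` and use `‖⟨y, x_n⟩‖ ≤ ‖s y‖`. The constant `N C`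
  -- would do; the `+ 1` keeps it positive when `N = 0`.
  have key : ∀ y, ‖y‖ ≤ (N * C + 1) * ‖s.toFun y‖ := fun y => by
    obtain ⟨a, ha, han⟩ := hb y
    rw [hΦ] at ha
    rcases eq_or_lt_of_le (norm_nonneg y) with h0 | h0
    · rw [← h0]
      positivity
    refine le_of_mul_le_mul_right ?_ h0
    calc ‖y‖ * ‖y‖ = ‖ip A y y‖ := by rw [norm_ip_self, sq]
      _ = ‖∑ n, ip A y (x n) * a n‖ := by
          conv_lhs => rw [← ha]
          rw [ip_sum_right, ha]
          simp only [ip_op_smul_right]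
      _ ≤ ∑ n : Fin N, ‖s.toFun y‖ * (C * ‖y‖) := by
          refine norm_sum_le_of_le _ fun n _ => (norm_mul_le _ _).trans ?_
          refine mul_le_mul ?_ ((norm_le_pi_norm a n).trans han) (norm_nonneg _) (norm_nonneg _)
          rw [← star_ip, norm_star]
          exact norm_adj_le_of_mul_self_eq_gram hs hss n y
      _ = N * C * ‖s.toFun y‖ * ‖y‖ := by simp; ring
      _ ≤ (N * C + 1) * ‖s.toFun y‖ * ‖y‖ := by gcongr; linarith
  have hsu := isUnit_of_bounded_below hs (by positivity) key
  rw [← hss]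
  exact hsu.mul hsu

/-- On an algebraically finitely generated module, all adjointable operators have finite rank. -/
theorem mem_finiteRank_of_isAFG (hX : IsAFG A X) (T : Adjointable A X X) :
    T ∈ Adjointable.finiteRank A X := by
  obtain ⟨N, x, hx⟩ := hX
  obtain ⟨R, hR⟩ := (isUnit_gram_of_generating hx).exists_left_inv
  -- With `G = ∑ θ_{x_n,x_n}` and `R G = 1`, one has `T = (T R) G`, which lies in the left ideal.
  have := mul_mem_finiteRank (T * R) (gram_incl_mem_finiteRank (A := A) x)
  rwa [mul_assoc, hR, mul_one] at this

/-! ### The frame defect `I - U⋆U` -/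

variable {ι : Type*}

/-- The operator `I - U⋆U`. -/
noncomputable def defect (v : ι → MulModule A X) (hv : IsBessel v ∨ IsOuterBessel v) :
    Adjointable A X X :=
  Adjointable.id A X - (analysis v hv).adjoint.comp (analysis v hv)

variable {v : ι → MulModule A X}

theorem ip_adjoint_comp_analysis (hv : IsBessel v ∨ IsOuterBessel v) (x : X) :
    ip A x (((analysis v hv).adjoint.comp (analysis v hv)).toFun x) =
      ∑' n, star (pair (v n) x) * pair (v n) x :=
  ((analysis v hv).ip_toFun x _).symm

theorem ip_defect (hv : IsBessel v ∨ IsOuterBessel v) (x : X) :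
    ip A x ((defect v hv).toFun x) = ip A x x - ∑' n, star (pair (v n) x) * pair (v n) x := by
  rw [← ip_adjoint_comp_analysis hv, ← ip_sub_right]
  rfl

theorem isSelfAdjoint_defect (hv : IsBessel v ∨ IsOuterBessel v) : IsSelfAdjoint (defect v hv) :=
  rfl

/-- The infimum need not itself be a Bessel bound (it is `0` for the zero sequence), so the
inequality is obtained for every `b > 1` and passed to the limit `b → 1`. -/
theorem defect_nonneg (hv : IsBessel v ∨ IsOuterBessel v) (hB : optimalBesselBound v ≤ 1) :
    0 ≤ defect v hv := by
  refine Adjointable.nonneg_of_ip_nonneg (isSelfAdjoint_defect hv) fun x => ?_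
  rw [ip_defect, sub_nonneg]
  have hlim : Filter.Tendsto (fun b : ℝ => b • ip A x x) (nhdsWithin 1 (Set.Ioi 1))
      (nhds (ip A x x)) := by
    have : Continuous fun b : ℝ => b • ip A x x := by fun_prop
    simpa using (this.tendsto 1).mono_left nhdsWithin_le_nhds
  refine ge_of_tendsto hlim ?_
  filter_upwards [self_mem_nhdsWithin] with b hb
  obtain ⟨B, hB1, hB2⟩ := exists_lt_of_csInf_lt (exists_besselBound hv) (hB.trans_lt hb)
  exact (hB1.2 x).2.trans (smul_le_smul_of_nonneg_right hB2.le (ip_self_nonneg x))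

/-- Some Bessel bound `B` is below `1`. The form estimate for `U⋆U` becomes `‖w‖ ≤ √B` for its
square root `w`, so `‖U⋆U‖ ≤ B < 1` and the Neumann series applies. -/
theorem isUnit_defect (hv : IsBessel v ∨ IsOuterBessel v) (hB : optimalBesselBound v < 1) :
    IsUnit (defect v hv) := by
  obtain ⟨B, hB1, hB2⟩ := exists_lt_of_csInf_lt (exists_besselBound hv) hB
  set W := (analysis v hv).adjoint.comp (analysis v hv) with hW
  have hW0 : 0 ≤ W := Adjointable.nonneg_of_ip_nonneg rfl fun x => by
    rw [hW, ip_adjoint_comp_analysis]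
    exact tsum_nonneg fun n => star_mul_self_nonneg _
  obtain ⟨w, hw0, hww⟩ := Adjointable.exists_sqrt hW0
  have hw := IsSelfAdjoint.of_nonneg hw0
  have h1 : ‖w‖ ≤ √B := Adjointable.norm_le_of_forall _ (Real.sqrt_nonneg _) fun x => by
    have h2 : ip A (w.toFun x) (w.toFun x) ≤ B • ip A x x := by
      rw [Adjointable.ip_toFun_comm hw, ← Adjointable.mul_toFun, hww, hW,
        ip_adjoint_comp_analysis]
      exact (hB1.2 x).2
    have h3 := CStarAlgebra.norm_le_norm_of_nonneg_of_le (ip_self_nonneg _) h2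
    rw [norm_smul, norm_ip_self, norm_ip_self, Real.norm_of_nonneg hB1.1.le] at h3
    refine le_of_sq_le_sq ?_ (by positivity)
    rwa [mul_pow, Real.sq_sqrt hB1.1.le]
  refine isUnit_one_sub_of_norm_lt_one (x := W) ?_
  rw [← hww]
  calc ‖w * w‖ ≤ ‖w‖ * ‖w‖ := norm_mul_le _ _
    _ ≤ √B * √B := by gcongr
    _ = B := Real.mul_self_sqrt hB1.1.le
    _ < 1 := hB2

/-- The series over the disjoint union splits into the finite sum over `f` and the series of `v`,
which converges to `⟨x, x⟩ - ⟨x, (I - U⋆U) x⟩`. -/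
theorem parsevalIdentity_sumElim_iff {κ : Type*} [Fintype κ] (hv : IsBessel v ∨ IsOuterBessel v)
    (f : κ → MulModule A X) :
    ParsevalIdentity (Sum.elim f v) ↔
      ∀ x, ∑ k, star ((f k).adj x) * (f k).adj x = ip A x ((defect v hv).toFun x) := by
  refine forall_congr' fun x => ?_
  obtain ⟨B, hB⟩ := exists_besselBound hv
  have h := HasSum.sum (f := fun n => star (pair (Sum.elim f v n) x) * pair (Sum.elim f v n) x)
    (hasSum_fintype _) (hB.2 x).1.hasSum
  rw [ip_defect hv]
  constructor
  · intro h'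
    rw [h'.unique h]
    exact (add_sub_cancel_right _ _).symm
  · intro h'
    convert h using 1
    exact (sub_add_cancel (ip A x x) _).symm.trans (congrArg (· + _) h'.symm)

/-- A subseries of a convergent series of positive elements converges to something no larger. -/
theorem isBesselBound_one_of_parseval {κ : Type*} {f : κ → MulModule A X}
    (h : ParsevalIdentity (Sum.elim f v)) : IsBesselBound v 1 := by
  refine ⟨one_pos, fun x => ?_⟩
  set g : κ ⊕ ι → A := fun n => star (pair (Sum.elim f v n) x) * pair (Sum.elim f v n) x with hg
  have hx : HasSum g (ip A x x) := h x
  have hs : Summable fun n => g (Sum.inr n) := hx.summable.comp_injective Sum.inr_injective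
  have hg0 : ∀ n, 0 ≤ g n := fun n => star_mul_self_nonneg _
  have hle : ∑' n, g (Sum.inr n) ≤ ip A x x :=
    hasSum_le_inj Sum.inr Sum.inr_injective (fun n _ => hg0 n) (fun _ => le_rfl) hs.hasSum hx
  refine ⟨hs, ?_⟩
  rw [one_smul]
  exact hle

theorem optimalBesselBound_le_one_of_parseval {κ : Type*} {f : κ → MulModule A X}
    (h : ParsevalIdentity (Sum.elim f v)) : optimalBesselBound v ≤ 1 :=
  csInf_le ⟨0, fun _ hB => hB.1.le⟩ (isBesselBound_one_of_parseval h)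

theorem defect_eq_gram {κ : Type*} [Fintype κ] (hv : IsBessel v ∨ IsOuterBessel v)
    {f : κ → MulModule A X} (h : ParsevalIdentity (Sum.elim f v)) : defect v hv = gram f :=
  Adjointable.eq_of_ip_eq (isSelfAdjoint_defect hv) (isSelfAdjoint_gram f) fun x => by
    rw [ip_gram, ((parsevalIdentity_sumElim_iff hv f).1 h x)]

theorem isParsevalFrame_or_isOuterParsevalFrame_iff {w : ι → MulModule A X} :
    IsParsevalFrame w ∨ IsOuterParsevalFrame w ↔ ParsevalIdentity w := by
  constructor
  · rintro (h | h) <;> exact h.2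
  · intro h
    by_cases h' : ∀ n, w n ∈ Set.range incl
    · exact Or.inl ⟨h', h⟩
    · exact Or.inr ⟨not_forall.1 h', h⟩

theorem hasParsevalOrOuterExtension_iff (hv : IsBessel v ∨ IsOuterBessel v) :
    HasParsevalOrOuterExtension v ↔ optimalBesselBound v ≤ 1 ∧
      ∃ θ ∈ MulModule.finiteRank A X, ∀ x : X, incl ((defect v hv).toFun x) = θ (incl x) := by
  simp only [HasParsevalOrOuterExtension, isParsevalFrame_or_isOuterParsevalFrame_iff]
  constructor
  · rintro ⟨N, f, hf⟩
    refine ⟨optimalBesselBound_le_one_of_parseval hf, ∑ k, MulModule.theta (f k) (f k),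
      Submodule.sum_mem _ fun k _ => Submodule.subset_span ⟨(f k, f k), rfl⟩, fun x => ?_⟩
    rw [defect_eq_gram hv hf, gram_toFun, Finset.sum_apply]
    change inclLinear A X _ = _
    rw [map_sum]
    refine Finset.sum_congr rfl fun k _ => ?_
    change incl ((f k).toFun ((f k).adj x)) = (f k).comp (innerM (f k) (incl x))
    rw [innerM_incl, incl_toFun]
    rfl
  · rintro ⟨hB, θ, hθ, h⟩
    -- Only the restriction of `θ` to `X` enters: there it is `∑ u_k w_k⋆` and equals the positive
    -- defect.
    obtain ⟨n, u, w, huw⟩ := exists_sum_of_mem_mulModule_finiteRank hθ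
    obtain ⟨N, f, hf, -⟩ := exists_sum_of_eq_sum (defect_nonneg hv hB) u w
      fun x => huw x _ (h x).symm
    exact ⟨N, f, (parsevalIdentity_sumElim_iff hv f).2 hf⟩

theorem hasParsevalExtension_iff (hv : IsBessel v) :
    HasParsevalExtension v ↔ optimalBesselBound v ≤ 1 ∧
      defect v (Or.inl hv) ∈ Adjointable.finiteRank A X := by
  constructor
  · rintro ⟨N, f, hf⟩
    refine ⟨optimalBesselBound_le_one_of_parseval hf.2, ?_⟩
    have h := defect_eq_gram (Or.inl hv) hf.2
    rw [h]
    exact gram_incl_mem_finiteRank f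
  · rintro ⟨hB, h⟩
    obtain ⟨n, y, z, hyz⟩ := exists_sum_of_mem_finiteRank h
    obtain ⟨N, f, hf, hfr⟩ := exists_sum_of_eq_sum (defect_nonneg (Or.inl hv) hB)
      (fun k => (incl (y k) : MulModule A X)) (fun k => incl (z k)) hyz
    -- As the factors `y_k`, `z_k` lie in `X`, so do the adjoined elements.
    choose g hg using hfr (fun k => ⟨y k, rfl⟩) (fun k => ⟨z k, rfl⟩)
    obtain rfl : (fun k => incl (g k)) = f := funext hg
    exact ⟨N, g, Sum.rec (fun k => ⟨g k, rfl⟩) hv.1,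
      (parsevalIdentity_sumElim_iff (Or.inl hv) _).2 hf⟩

end

end HilbertMod

/-! ### The extension theorem. -/

open HilbertMod MulModule in
theorem theorem6p7
    {A : Type*} [NonUnitalCStarAlgebra A] [PartialOrder A] [StarOrderedRing A]
    {X : Type*} [NormedAddCommGroup X] [NormedSpace ℂ X] [CompleteSpace X]
    [SMul Aᵐᵒᵖ X] [CStarModule Aᵐᵒᵖ X]
    {ι : Type*} [Countable ι] :
    -- extensions by members of `M(X)`
    (∀ (v : ι → MulModule A X) (hv : IsBessel v ∨ IsOuterBessel v),
      HasParsevalOrOuterExtension v ↔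
        optimalBesselBound v ≤ 1 ∧
        ∃ θ ∈ MulModule.finiteRank A X, ∀ x : X,
          incl ((Adjointable.id A X - (analysis v hv).adjoint.comp (analysis v hv)).toFun x)
            = θ (incl x)) ∧
    -- extensions of Bessel sequences by members of `X`
    (∀ (x : ι → X) (hx : IsBessel fun n => (incl (x n) : MulModule A X)),
      let v : ι → MulModule A X := fun n => incl (x n)
      let U := analysis v (Or.inl hx)
      (¬ IsAFG A X →
        (HasParsevalExtension v ↔
          Adjointable.id A X - U.adjoint.comp U ∈ Adjointable.finiteRank A X ∧
          optimalBesselBound v = 1)) ∧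
      (IsAFG A X → (HasParsevalExtension v ↔ optimalBesselBound v ≤ 1))) := by
  refine ⟨fun v hv => hasParsevalOrOuterExtension_iff hv, fun x hx => ⟨fun hX => ?_, fun hX => ?_⟩⟩
  · refine (hasParsevalExtension_iff hx).trans ⟨fun h => ⟨h.2, ?_⟩, fun h => ⟨h.2.le, h.1⟩⟩
    -- If `B < 1`, the defect would be invertible and of finite rank, forcing `X` to be
    -- algebraically finitely generated.
    refine h.1.eq_or_lt.resolve_right fun hlt => hX ?_
    exact isAFG_of_isUnit_mem_finiteRank (isUnit_defect (Or.inl hx) hlt) h.2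
  · exact (hasParsevalExtension_iff hx).trans
      ⟨And.left, fun h => ⟨h, mem_finiteRank_of_isAFG hX _⟩⟩
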